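/- \textbf{Setting.} $\lambda$-terms $M::=x\mid\lambda x.M\mid MN$ and agents of the asynchronous polyadic $\pi$-calculus, both up to $\alpha$-conversion. Agents are processes $P::=0\mid a(\tilde b).P\mid \bar a\langle\tilde b\rangle\mid P|P\mid \nu a\,P\mid\, !a(\tilde b).P\mid F\langle a\rangle$ and abstractions $F::=(a)P$, and obey an arbitrary fixed sorting. The $\lambda$-variables are among the names. Contexts may have several indexed holes, which stand for processes or abstractions, and their binders capture names. Head reduction contracts the redex $(\lambda x.M_0)M_1$ in $\lambda x_1\ldots x_m.(\lambda x.M_0)M_1\cdots M_k$ ($k\ge 1$). A term is solvable if it head-reduces to a head normal form $\lambda x_1\ldots x_n.\,yM_1\cdots M_k$. An unsolvable has order $n$ if $n$ is the largest number such that it head-reduces to some $\lambda x_1\ldots x_n.M'$, and order $\infty$ if there is no largest such $n$. The Lévy–Longo tree $LT(M)$ is defined coinductively: it is $\top$ if $M$ is unsolvable of order $\infty$; $\lambda x_1\ldots x_n.\bot$ if $M$ is unsolvable of order $n$; and if $M$ has head normal form $\lambda\tilde x.\,yM_1\cdots M_k$, it is the tree with root $\lambda\tilde x.y$ and children $LT(M_1),\dots,LT(M_k)$.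 The Böhm tree $BT(M)$ is defined in the same way, but it is $\bot$ for all unsolvable $M$. Trees are taken up to $\alpha$-conversion. An encoding $[\![\cdot]\!]$ maps $\lambda$-terms to abstractions over a name of a fixed sort, and is compositional and uniform. Compositional: $[\![x]\!]=T_x$, $[\![\lambda x.M]\!]=C^x_\lambda[[\![M]\!]]$ and $[\![MN]\!]=C_{app}[[\![M]\!],[\![N]\!]]$ for fixed agents $T_x$ and contexts $C^x_\lambda$, $C_{app}$, where $x$ occurs in $C^x_\lambda$ only bound, with a scope that embraces the hole. Uniform: $[\![M\sigma]\!]=[\![M]\!]\sigma$ for every substitution $\sigma$ of variables for variables, and all free names of $[\![M]\!]$ are free variables of $M$. The abstraction contexts are the $C^x_\lambda$; the variable contexts are $C^{x,n}_{var}=[\![x[\cdot]_1\cdots[\cdot]_n]\!]$, $n\ge0$. It is sound for LTs (BTs) with respect to $\asymp$ if $[\![M]\!]\asymp[\![N]\!]$ implies $LT(M)=LT(N)$ ($BT(M)=BT(N)$) for all $M,N$. A precongruence is a preorder on agents preserved by all contexts, and a congruence is a symmetric precongruence. A precongruence $\le$ is plain if $P\{b/a\}\le((a)P)\langle b\rangle$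 for all $P,a,b$. A relation $\mathcal R$ has the rendez-vous cancellation property if $\nu\tilde b\,(\bar a\langle\tilde c\rangle\mid b(r).P)\ \mathcal R\ \nu\tilde b\,(\bar a\langle\tilde c\rangle\mid b(r).Q)$ with $b\in\tilde b\subseteq\tilde c$ and $a,b$ fresh implies $P\,\mathcal R\,Q$. An abstraction context $C$ with $n$ holes for abstractions has inverse with respect to $\mathcal R$ if, for each $i\le n$ and each finite set $X$ of names, there are a process context $D$, tuples $\tilde b,\tilde c$ and names $a,b,z$ with $b\in\tilde b\subseteq\tilde c$ and $a,b,z$ fresh (in particular, not in $X$) such that $D[C[A_1,\dots,A_n]]\ \mathcal R\ \nu\tilde b\,(\bar a\langle\tilde c\rangle\mid b(z).A_i\langle z\rangle)$ for all abstractions $A_1,\dots,A_n$ whose free names are $\lambda$-variables in $X$. \textbf{Theorem (soundness conditions).} Let $[\![\cdot]\!]$ be an encoding, and let $\asymp$ and $\le$ be relations on agents such that, with $\ge$ the converse of $\le$: \begin{enumerate} \item $\asymp$ is a congruence and $\le$ is a plain precongruence; \item ${\ge}\subseteq{\asymp}$; \item $\asymp$ has the rendez-vous cancellation property; \item $[\![\cdot]\!]$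 and $\ge$ validate rule $\beta$, that is, $[\![(\lambda x.M)N]\!]\ge[\![M\{N/x\}]\!]$ for all $x,M,N$; \item if $M$ is unsolvable of order $0$, then $[\![M]\!]\asymp[\![\Omega]\!]$, where $\Omega=(\lambda x.xx)(\lambda x.xx)$; \item $[\![\Omega]\!]$, $[\![x\tilde M]\!]$, $[\![x\tilde M']\!]$ and $[\![y\tilde M'']\!]$ are pairwise unrelated by $\asymp$ whenever $x\ne y$ and the tuples $\tilde M,\tilde M'$ have different lengths; \item the abstraction contexts and the variable contexts of $[\![\cdot]\!]$ have inverse with respect to $\ge$. \end{enumerate} Then: \begin{itemize} \item[(i)] if, for all $x,M$, $[\![\lambda x.M]\!]$ is unrelated by $\asymp$ to $[\![\Omega]\!]$ and to any term of the form $[\![y\tilde M]\!]$, then $[\![\cdot]\!]$ and $\asymp$ are sound for LTs; \item[(ii)] if $[\![M]\!]\asymp[\![\Omega]\!]$ whenever $M$ is unsolvable of order $\infty$, and if, for all $x$ and all solvable $M$, $[\![\lambda x.M]\!]$ is unrelated by $\asymp$ to $[\![\Omega]\!]$ and to any term of the form $[\![y\tilde M]\!]$, then $[\![\cdot]\!]$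 and $\asymp$ are sound for BTs. \end{itemize} -/

import Mathlib

/-! ## The untyped lambda-calculus

Terms modulo alpha-conversion, in de Bruijn form.  The variables are the natural numbers, and in a
term the variable `k` occurs free as the index `k` (shifted by the number of enclosing binders). -/

/-- Lambda-terms modulo alpha-conversion; `bind M` binds the index `0` of `M`. -/
inductive Term : Type
  | var (k : ℕ)
  | bind (M : Term)
  | app (M N : Term)

namespace Term

/-- The action under one more binder of a map on indices. -/
def liftRen (ρ : ℕ → ℕ) : ℕ → ℕ
  | 0 => 0
  | k + 1 => ρ k + 1

/-- Substitution of variables for variables. -/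
def rename : (ℕ → ℕ) → Term → Term
  | ρ, var k => var (ρ k)
  | ρ, bind M => bind (rename (liftRen ρ) M)
  | ρ, app M N => app (rename ρ M) (rename ρ N)

/-- The action under one more binder of a substitution. -/
def liftSub (θ : ℕ → Term) : ℕ → Term
  | 0 => var 0
  | k + 1 => rename Nat.succ (θ k)

/-- Simultaneous capture-avoiding substitution of terms for variables. -/
def msubst : (ℕ → Term) → Term → Term
  | θ, var k => θ k
  | θ, bind M => bind (msubst (liftSub θ) M)
  | θ, app M N => app (msubst θ M) (msubst θ N)

/-- The substitution `M{N/x}`. -/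
def subst (M : Term) (x : ℕ) (N : Term) : Term :=
  msubst (fun k => if k = x then N else var k) M

/-- The abstraction `λ x. M`, for a variable `x`. -/
def lam (x : ℕ) (M : Term) : Term :=
  bind (rename (fun k => if k = x then 0 else k + 1) M)

/-- The free variables of a term. -/
def fv : Term → Set ℕ
  | var k => {k}
  | bind M => {k | k + 1 ∈ fv M}
  | app M N => fv M ∪ fv N

/-- `M M₁ ⋯ Mₙ` -/
def apps (M : Term) (Ms : List Term) : Term := Ms.foldl app M

/-- `n` nested abstractions. -/
def binds : ℕ → Term → Term
  | 0, M => M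
  | n + 1, M => bind (binds n M)

/-- `Ω = (λ x. x x) (λ x. x x)` -/
def Omega : Term :=
  app (lam 0 (app (var 0) (var 0))) (lam 0 (app (var 0) (var 0)))

/-- The term is an abstraction. -/
def IsLam (M : Term) : Prop := ∃ M', M = bind M'

/-- The contractum of the redex `(bind M) N`. -/
def contract (M N : Term) : Term :=
  msubst (fun k => match k with | 0 => N | k + 1 => var k) M

/-- One step of head reduction: contraction of the redex `(λ x. M₀) M₁` in a term
`λ x₁ … xₘ. (λ x. M₀) M₁ ⋯ Mₙ`. -/
inductive HeadStep : Term → Term → Prop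
  | beta (M N : Term) : HeadStep (app (bind M) N) (contract M N)
  | appL {M M' : Term} (N : Term) : ¬ IsLam M → HeadStep M M' → HeadStep (app M N) (app M' N)
  | under {M M' : Term} : HeadStep M M' → HeadStep (bind M) (bind M')

/-- Head reduction. -/
def HeadRed : Term → Term → Prop := Relation.ReflTransGen HeadStep

/-- `M` head-reduces to the head normal form `λ x₁ … xₙ. y M₁ ⋯ Mₖ`. -/
def HasHnf (M : Term) (n y : ℕ) (Ms : List Term) : Prop :=
  HeadRed M (binds n (apps (var y) Ms))

/-- `M` has a head normal form. -/
def Solvable (M : Term) : Prop := ∃ n y Ms, HasHnf M n y Ms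

/-- Head reduction from `M` uncovers at least `n` abstractions. -/
def Uncovers (M : Term) (n : ℕ) : Prop := ∃ M', HeadRed M (binds n M')

/-- `M` is an unsolvable of (finite) order `n`. -/
def UnsolvableOfOrder (M : Term) (n : ℕ) : Prop :=
  ¬ Solvable M ∧ IsGreatest {m | Uncovers M m} n

/-- `M` is an unsolvable of infinite order. -/
def UnsolvableOfInfiniteOrder (M : Term) : Prop :=
  ¬ Solvable M ∧ ∀ n, Uncovers M n

end Term

/-! ## Lévy-Longo trees and Böhm trees

Possibly infinite trees, as elements of coinductive types.  Head variables are de Bruijn indices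
that count the binders met on the path from the root, so equality is equality of
trees modulo alpha-conversion. -/

/-- Labels of Lévy-Longo trees: `⊤`, `λ x₁ … xₙ. ⊥`, and `λ x₁ … xₙ. y` with `k` children. -/
inductive LTLabel : Type
  | top
  | bot (n : ℕ)
  | node (n y k : ℕ)

/-- The number of children below a label. -/
def LTLabel.arity : LTLabel → ℕ
  | top => 0
  | bot _ => 0
  | node _ _ k => k

/-- Labels of Böhm trees: `⊥`, and `λ x₁ … xₙ. y` with `k` children. -/
inductive BTLabel : Type
  | bot
  | node (n y k : ℕ)

/-- The number of children below a label. -/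
def BTLabel.arity : BTLabel → ℕ
  | bot => 0
  | node _ _ k => k

/-- One layer of a Lévy-Longo tree. -/
def LTShape : PFunctor := ⟨LTLabel, fun l => Fin l.arity⟩

/-- One layer of a Böhm tree. -/
def BTShape : PFunctor := ⟨BTLabel, fun l => Fin l.arity⟩

open Classical in
/-- The root of the Lévy-Longo tree of a term, with the terms whose trees are its children. -/
noncomputable def ltStep (M : Term) : LTShape Term :=
  if h : ∃ p : ℕ × ℕ × List Term, M.HasHnf p.1 p.2.1 p.2.2 then
    ⟨LTLabel.node h.choose.1 h.choose.2.1 h.choose.2.2.length, fun i => h.choose.2.2.get i⟩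
  else if h : ∃ n, M.UnsolvableOfOrder n then
    ⟨LTLabel.bot h.choose, Fin.elim0⟩
  else ⟨LTLabel.top, Fin.elim0⟩

open Classical in
/-- The root of the Böhm tree of a term, with the terms whose trees are its children. -/
noncomputable def btStep (M : Term) : BTShape Term :=
  if h : ∃ p : ℕ × ℕ × List Term, M.HasHnf p.1 p.2.1 p.2.2 then
    ⟨BTLabel.node h.choose.1 h.choose.2.1 h.choose.2.2.length, fun i => h.choose.2.2.get i⟩
  else ⟨BTLabel.bot, Fin.elim0⟩

/-- The Lévy-Longo tree of a term. -/
noncomputable def levyLongoTree (M : Term) : LTShape.M := PFunctor.M.corec ltStep M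

/-- The Böhm tree of a term. -/
noncomputable def bohmTree (M : Term) : BTShape.M := PFunctor.M.corec btStep M

/-! ## The asynchronous polyadic pi-calculus -/

/-- A sorting: a set of sorts, with a relation telling which tuples of sorts may be carried by
a name of a given sort.  A sort discipline by a (partial) function from sorts to tuples is
the case of a functional relation; the calculus without sorts is the case of one sort that
carries everything. `varSort` is the sort of the lambda-variables. -/
structure Sorting where
  Srt : Type
  carries : Srt → List Srt → Prop
  varSort : Srt

/-- Names: the lambda-variables, and for every sort infinitely many further names. -/
inductive Name (S : Sorting) : Type
  | var (k : ℕ)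
  | aux (s : S.Srt) (k : ℕ)

/-- The sort of a name. -/
def Name.sort {S : Sorting} : Name S → S.Srt
  | var _ => S.varSort
  | aux s _ => s

/-- The name is a lambda-variable. -/
def Name.IsVar {S : Sorting} (n : Name S) : Prop := ∃ k, n = Name.var k

/-- An agent is a process, or an abstraction over a name of sort `s`. -/
inductive Kind (S : Sorting) : Type
  | proc
  | abs (s : S.Srt)

/-- The names in `N` and one more name for each entry of `ss`. -/
abbrev WithBound {S : Sorting} (ss : List S.Srt) (N : Type) : Type := Fin ss.length ⊕ N

/-- The sorts of the names in `WithBound ss N`. -/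
abbrev boundSort {S : Sorting} {N : Type} (ss : List S.Srt) (σ : N → S.Srt) : WithBound ss N → S.Srt :=
  Sum.elim ss.get σ

/-- Well-sorted agents modulo alpha-conversion whose free names are taken from a type `N`
with sorts `σ`.  The body of a binder has additional free names that stand for the bound ones. -/
inductive PreAgent (S : Sorting) : (N : Type) → (N → S.Srt) → Kind S → Type 1
  | nil {N : Type} {σ : N → S.Srt} : PreAgent S N σ Kind.proc
  | inp {N : Type} {σ : N → S.Srt} (a : N) (ss : List S.Srt) (h : S.carries (σ a) ss)
      (P : PreAgent S (WithBound ss N) (boundSort ss σ) Kind.proc) : PreAgent S N σ Kind.proc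
  | out {N : Type} {σ : N → S.Srt} (a : N) (bs : List N) (h : S.carries (σ a) (bs.map σ)) :
      PreAgent S N σ Kind.proc
  | par {N : Type} {σ : N → S.Srt} (P Q : PreAgent S N σ Kind.proc) : PreAgent S N σ Kind.proc
  | res {N : Type} {σ : N → S.Srt} (s : S.Srt)
      (P : PreAgent S (WithBound [s] N) (boundSort [s] σ) Kind.proc) : PreAgent S N σ Kind.proc
  | bang {N : Type} {σ : N → S.Srt} (a : N) (ss : List S.Srt) (h : S.carries (σ a) ss)
      (P : PreAgent S (WithBound ss N) (boundSort ss σ) Kind.proc) : PreAgent S N σ Kind.proc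
  | app {N : Type} {σ : N → S.Srt} {s : S.Srt} (F : PreAgent S N σ (Kind.abs s)) (b : N)
      (h : σ b = s) : PreAgent S N σ Kind.proc
  | abs {N : Type} {σ : N → S.Srt} (s : S.Srt)
      (P : PreAgent S (WithBound [s] N) (boundSort [s] σ) Kind.proc) : PreAgent S N σ (Kind.abs s)

namespace PreAgent

variable {S : Sorting}

theorem boundSort_map {N N' : Type} {σ : N → S.Srt} {σ' : N' → S.Srt} {ρ : N → N'}
    (hρ : ∀ n, σ' (ρ n) = σ n) (ss : List S.Srt) (n : WithBound ss N) :
    boundSort ss σ' (Sum.map id ρ n) = boundSort ss σ n := by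
  cases n <;> simp [hρ]

/-- Sort-preserving substitution of names for free names. -/
def rename : {N : Type} → {σ : N → S.Srt} → {κ : Kind S} → PreAgent S N σ κ →
    {N' : Type} → {σ' : N' → S.Srt} → (ρ : N → N') → (∀ n, σ' (ρ n) = σ n) → PreAgent S N' σ' κ
  | _, _, _, nil, _, _, _, _ => nil
  | _, _, _, inp a ss h P, _, _, ρ, hρ =>
      inp (ρ a) ss (by rw [hρ]; exact h) (rename P (Sum.map id ρ) (boundSort_map hρ ss))
  | _, _, _, out a bs h, _, _, ρ, hρ =>
      out (ρ a) (bs.map ρ) (by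
        rw [hρ, List.map_map]
        rwa [show _ ∘ ρ = _ from funext hρ])
  | _, _, _, par P Q, _, _, ρ, hρ => par (rename P ρ hρ) (rename Q ρ hρ)
  | _, _, _, res s P, _, _, ρ, hρ => res s (rename P (Sum.map id ρ) (boundSort_map hρ [s]))
  | _, _, _, bang a ss h P, _, _, ρ, hρ =>
      bang (ρ a) ss (by rw [hρ]; exact h) (rename P (Sum.map id ρ) (boundSort_map hρ ss))
  | _, _, _, app F b h, _, _, ρ, hρ => app (rename F ρ hρ) (ρ b) (by rw [hρ]; exact h)
  | _, _, _, abs s P, _, _, ρ, hρ => abs s (rename P (Sum.map id ρ) (boundSort_map hρ [s]))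

/-- Free names. -/
def fn : {N : Type} → {σ : N → S.Srt} → {κ : Kind S} → PreAgent S N σ κ → Set N
  | _, _, _, nil => ∅
  | _, _, _, inp a _ _ P => {a} ∪ {n | Sum.inr n ∈ fn P}
  | _, _, _, out a bs _ => {a} ∪ {n | n ∈ bs}
  | _, _, _, par P Q => fn P ∪ fn Q
  | _, _, _, res _ P => {n | Sum.inr n ∈ fn P}
  | _, _, _, bang a _ _ P => {a} ∪ {n | Sum.inr n ∈ fn P}
  | _, _, _, app F b _ => fn F ∪ {b}
  | _, _, _, abs _ P => {n | Sum.inr n ∈ fn P}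

end PreAgent

/-- Agents of the pi-calculus modulo alpha-conversion. -/
abbrev Agent (S : Sorting) (κ : Kind S) : Type 1 := PreAgent S (Name S) Name.sort κ

/-- Processes. -/
abbrev Proc (S : Sorting) : Type 1 := Agent S Kind.proc

/-- Abstractions over a name of sort `s`. -/
abbrev Abst (S : Sorting) (s : S.Srt) : Type 1 := Agent S (Kind.abs s)

section Agents

variable {S : Sorting}

open Classical in
/-- Turns the occurrences of the names `bs` into bound ones, and leaves the other names alone. -/
noncomputable def bindNames (bs : List (Name S)) (n : Name S) : WithBound (bs.map Name.sort) (Name S) :=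
  if h : n ∈ bs then
    Sum.inl ⟨bs.idxOf n, by rw [List.length_map]; exact List.idxOf_lt_length_of_mem h⟩
  else Sum.inr n

theorem sort_bindNames (bs : List (Name S)) (n : Name S) :
    boundSort (bs.map Name.sort) Name.sort (bindNames bs n) = n.sort := by
  unfold bindNames
  split
  · simp
  · rfl

open Classical in
/-- The substitution `{b/a}` on names. -/
noncomputable def substName (b a n : Name S) : Name S := if n = a then b else n

theorem sort_substName {a b : Name S} (h : b.sort = a.sort) (n : Name S) :
    (substName b a n).sort = n.sort := by
  unfold substName
  split
  · next hn => rw [hn, h]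
  · rfl

/-- The action on names of a substitution of lambda-variables for lambda-variables. -/
def varSubst (ρ : ℕ → ℕ) : Name S → Name S
  | Name.var k => Name.var (ρ k)
  | Name.aux s k => Name.aux s k

theorem sort_varSubst (ρ : ℕ → ℕ) (n : Name S) : (varSubst ρ n).sort = n.sort := by
  cases n <;> rfl

/-- The process `P{b/a}`. -/
noncomputable def Proc.subst (P : Proc S) (b a : Name S) (h : b.sort = a.sort) : Proc S :=
  P.rename (substName b a) (sort_substName h)

/-- `a(b₁, …, bₙ). P` -/
noncomputable def Proc.inp (a : Name S) (bs : List (Name S))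
    (h : S.carries a.sort (bs.map Name.sort)) (P : Proc S) : Proc S :=
  PreAgent.inp a (bs.map Name.sort) h (P.rename (bindNames bs) (sort_bindNames bs))

/-- `! a(b₁, …, bₙ). P` -/
noncomputable def Proc.bang (a : Name S) (bs : List (Name S))
    (h : S.carries a.sort (bs.map Name.sort)) (P : Proc S) : Proc S :=
  PreAgent.bang a (bs.map Name.sort) h (P.rename (bindNames bs) (sort_bindNames bs))

/-- `ν a. P` -/
noncomputable def Proc.res (a : Name S) (P : Proc S) : Proc S :=
  PreAgent.res a.sort (P.rename (bindNames [a]) (sort_bindNames [a]))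

/-- `ν b₁ … bₙ. P` -/
noncomputable def Proc.ress (bs : List (Name S)) (P : Proc S) : Proc S := bs.foldr Proc.res P

/-- The abstraction `(a) P`. -/
noncomputable def Abst.mk (a : Name S) (P : Proc S) : Abst S a.sort :=
  PreAgent.abs a.sort (P.rename (bindNames [a]) (sort_bindNames [a]))

/-- The application `F⟨b⟩`. -/
def Abst.app {s : S.Srt} (F : Abst S s) (b : Name S) (h : b.sort = s) : Proc S :=
  PreAgent.app F b h

end Agents

/-- Contexts with holes `[·]ᵢ`, `i < n`, where `[·]ᵢ` stands for an agent of kind `κs i`.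
Any hole may occur any number of times.  The binders of a context are named, and capture. -/
inductive Ctx (S : Sorting) {n : ℕ} (κs : Fin n → Kind S) : Kind S → Type 1
  | hole (i : Fin n) : Ctx S κs (κs i)
  | const {κ : Kind S} (A : Agent S κ) : Ctx S κs κ
  | inp (a : Name S) (bs : List (Name S)) (hb : bs.Nodup)
      (h : S.carries a.sort (bs.map Name.sort)) (C : Ctx S κs Kind.proc) : Ctx S κs Kind.proc
  | par (C D : Ctx S κs Kind.proc) : Ctx S κs Kind.proc
  | res (a : Name S) (C : Ctx S κs Kind.proc) : Ctx S κs Kind.proc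
  | bang (a : Name S) (bs : List (Name S)) (hb : bs.Nodup)
      (h : S.carries a.sort (bs.map Name.sort)) (C : Ctx S κs Kind.proc) : Ctx S κs Kind.proc
  | app {s : S.Srt} (C : Ctx S κs (Kind.abs s)) (b : Name S) (h : b.sort = s) : Ctx S κs Kind.proc
  | abs (a : Name S) (C : Ctx S κs Kind.proc) : Ctx S κs (Kind.abs a.sort)

namespace Ctx

variable {S : Sorting} {n : ℕ} {κs : Fin n → Kind S}

/-- The agent `C[A₁, …, Aₙ]`. -/
noncomputable def fill (A : (i : Fin n) → Agent S (κs i)) : {κ : Kind S} → Ctx S κs κ → Agent S κ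
  | _, hole i => A i
  | _, const B => B
  | _, inp a bs _ h C => Proc.inp a bs h (fill A C)
  | _, par C D => PreAgent.par (fill A C) (fill A D)
  | _, res a C => Proc.res a (fill A C)
  | _, bang a bs _ h C => Proc.bang a bs h (fill A C)
  | _, app C b h => Abst.app (fill A C) b h
  | _, abs a C => Abst.mk a (fill A C)

/-- The context `C[D₁, …, Dₙ]`. -/
def comp {m : ℕ} {κs' : Fin m → Kind S} (D : (i : Fin n) → Ctx S κs' (κs i)) :
    {κ : Kind S} → Ctx S κs κ → Ctx S κs' κ
  | _, hole i => D i
  | _, const B => const B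
  | _, inp a bs hb h C => inp a bs hb h (comp D C)
  | _, par C C' => par (comp D C) (comp D C')
  | _, res a C => res a (comp D C)
  | _, bang a bs hb h C => bang a bs hb h (comp D C)
  | _, app C b h => app (comp D C) b h
  | _, abs a C => abs a (comp D C)

/-- The free names of a context. -/
def fn : {κ : Kind S} → Ctx S κs κ → Set (Name S)
  | _, hole _ => ∅
  | _, const B => B.fn
  | _, inp a bs _ _ C => {a} ∪ (fn C \ {x | x ∈ bs})
  | _, par C D => fn C ∪ fn D
  | _, res a C => fn C \ {a}
  | _, bang a bs _ _ C => {a} ∪ (fn C \ {x | x ∈ bs})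
  | _, app C b _ => fn C ∪ {b}
  | _, abs a C => fn C \ {a}

/-- Every hole of the context lies in the scope of a binder for `x`. -/
def Embraces (x : Name S) : {κ : Kind S} → Ctx S κs κ → Prop
  | _, hole _ => False
  | _, const _ => True
  | _, inp _ bs _ _ C => x ∈ bs ∨ Embraces x C
  | _, par C D => Embraces x C ∧ Embraces x D
  | _, res a C => x = a ∨ Embraces x C
  | _, bang _ bs _ _ C => x ∈ bs ∨ Embraces x C
  | _, app C _ _ => Embraces x C
  | _, abs a C => x = a ∨ Embraces x C

end Ctx

/-! ## Relations on agents -/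

/-- Relations on agents. -/
def AgentRel (S : Sorting) : Type 1 := ⦃κ : Kind S⦄ → Agent S κ → Agent S κ → Prop

/-- The converse of a relation on agents. -/
def AgentRel.converse {S : Sorting} (R : AgentRel S) : AgentRel S := fun _ A B => R B A

section Relations

variable {S : Sorting}

/-- Preservation by all contexts. -/
def PreservedByContexts (R : AgentRel S) : Prop :=
  ∀ (n : ℕ) (κs : Fin n → Kind S) (κ : Kind S) (C : Ctx S κs κ)
    (A B : (i : Fin n) → Agent S (κs i)), (∀ i, R (A i) (B i)) → R (C.fill A) (C.fill B)

/-- A precongruence is a preorder preserved by all contexts. -/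
structure IsPrecongruence (R : AgentRel S) : Prop where
  refl : ∀ ⦃κ : Kind S⦄ (A : Agent S κ), R A A
  trans : ∀ ⦃κ : Kind S⦄ ⦃A B C : Agent S κ⦄, R A B → R B C → R A C
  ctx : PreservedByContexts R

/-- A congruence is a symmetric precongruence. -/
structure IsCongruence (R : AgentRel S) : Prop extends IsPrecongruence R where
  symm : ∀ ⦃κ : Kind S⦄ ⦃A B : Agent S κ⦄, R A B → R B A

/-- A relation `≤` is plain if `P{b/a} ≤ ((a) P)⟨b⟩`: instantiating the parameter of an
abstraction goes from a larger agent to a smaller one. -/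
def IsPlain (le : AgentRel S) : Prop :=
  ∀ (P : Proc S) (a b : Name S) (h : b.sort = a.sort),
    le (P.subst b a h) ((Abst.mk a P).app b h)

/-- `ν b₁ … bₘ. (a⟨c₁, …, cₙ⟩ | b(r). P)`, where `a⟨c₁, …, cₙ⟩` is an output. -/
noncomputable def rendezvous (bs : List (Name S)) (a : Name S) (cs : List (Name S))
    (hac : S.carries a.sort (cs.map Name.sort)) (b r : Name S)
    (hbr : S.carries b.sort ([r].map Name.sort)) (P : Proc S) : Proc S :=
  Proc.ress bs (PreAgent.par (PreAgent.out a cs hac) (Proc.inp b [r] hbr P))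

/-- The rendez-vous cancellation property. -/
def RendezvousCancellation (R : AgentRel S) : Prop :=
  ∀ (bs : List (Name S)) (a : Name S) (cs : List (Name S))
    (hac : S.carries a.sort (cs.map Name.sort)) (b r : Name S)
    (hbr : S.carries b.sort ([r].map Name.sort)) (P Q : Proc S),
    b ∈ bs → bs ⊆ cs → a ∉ cs → a ≠ r → b ≠ r →
    a ∉ P.fn → a ∉ Q.fn → b ∉ P.fn → b ∉ Q.fn →
    R (rendezvous bs a cs hac b r hbr P) (rendezvous bs a cs hac b r hbr Q) → R P Q

/-- The context `C`, an abstraction whose holes stand for abstractions, has inverse with respect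
to `R`: for each hole there is a process context that extracts the content of that hole,
behind a rendez-vous.  The extracting context and the names in the rendez-vous do not depend
on what fills the holes, except that `a`, `b`, `z` are fresh for it.  The fillers `A` are the
abstractions whose free names are lambda-variables, so that the auxiliary names bound in
`C` do not capture names by accident. -/
def HasInverse (R : AgentRel S) {n : ℕ} {ss : Fin n → S.Srt} {s : S.Srt}
    (C : Ctx S (fun i => Kind.abs (ss i)) (Kind.abs s)) : Prop :=
  ∀ (i : Fin n) (X : Finset (Name S)),
    ∃ (D : Ctx S (fun _ : Fin 1 => Kind.abs s) Kind.proc)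
      (bs cs : List (Name S)) (a b z : Name S)
      (hac : S.carries a.sort (cs.map Name.sort))
      (hbz : S.carries b.sort ([z].map Name.sort)) (hz : z.sort = ss i),
      b ∈ bs ∧ bs ⊆ cs ∧ a ∉ cs ∧ z ∉ cs ∧ a ≠ z ∧ a ∉ X ∧ b ∉ X ∧ z ∉ X ∧
      ∀ A : (j : Fin n) → Abst S (ss j), (∀ j, ∀ m ∈ (A j).fn, m.IsVar ∧ m ∈ X) →
        R (D.fill (fun _ => C.fill A)) (rendezvous bs a cs hac b z hbz ((A i).app z hz))

end Relations

/-! ## Encodings of the lambda-calculus into the pi-calculus -/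

/-- A compositional and uniform encoding.  Lambda-terms are mapped to abstractions over
a name of sort `loc`. -/
structure Encoding (S : Sorting) where
  /-- the sort of the parameter of the encoding -/
  loc : S.Srt
  /-- the encoding -/
  enc : Term → Abst S loc
  /-- the encoding of a variable -/
  varAbs : ℕ → Abst S loc
  /-- the abstraction contexts -/
  absCtx : ℕ → Ctx S (fun _ : Fin 1 => Kind.abs loc) (Kind.abs loc)
  /-- the context for applications -/
  appCtx : Ctx S (fun _ : Fin 2 => Kind.abs loc) (Kind.abs loc)
  enc_var : ∀ x, enc (Term.var x) = varAbs x
  enc_lam : ∀ x M, enc (Term.lam x M) = (absCtx x).fill (fun _ => enc M)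
  enc_app : ∀ M N, enc (Term.app M N) = appCtx.fill ![enc M, enc N]
  /-- `x` occurs in the abstraction context only as a bound name, … -/
  absCtx_fn : ∀ x, Name.var x ∉ (absCtx x).fn
  /-- … with a scope that embraces the hole. -/
  absCtx_embraces : ∀ x, (absCtx x).Embraces (Name.var x)
  /-- The encoding commutes with the substitution of variables for variables. -/
  uniform : ∀ (ρ : ℕ → ℕ) M, enc (M.rename ρ) = (enc M).rename (varSubst ρ) (sort_varSubst ρ)
  /-- The encoding does not introduce free names. -/
  fn_enc : ∀ M, ∀ m ∈ (enc M).fn, ∃ k ∈ M.fv, m = Name.var k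

namespace Encoding

variable {S : Sorting} (E : Encoding S)

/-- The variable context with `n` holes, the encoding of `x [·]₁ ⋯ [·]ₙ`. -/
def varCtx (x : ℕ) : (n : ℕ) → Ctx S (fun _ : Fin n => Kind.abs E.loc) (Kind.abs E.loc)
  | 0 => Ctx.const (E.varAbs x)
  | n + 1 => E.appCtx.comp
      ![(varCtx x n).comp (fun i => Ctx.hole i.castSucc), Ctx.hole (Fin.last n)]

/-- The encoding and `R` validate rule beta. -/
def ValidatesBeta (R : AgentRel S) : Prop :=
  ∀ (x : ℕ) (M N : Term), R (E.enc (Term.app (Term.lam x M) N)) (E.enc (M.subst x N))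

/-- The encoding of `Ω`, and the encodings of the terms `x M₁ ⋯ Mₙ`, are pairwise unrelated
by `R` when the head variables or the numbers of arguments are distinct. -/
structure HeadsUnrelated (R : AgentRel S) : Prop where
  omega : ∀ (x : ℕ) (Ms : List Term),
    ¬ R (E.enc Term.Omega) (E.enc ((Term.var x).apps Ms))
  length : ∀ (x : ℕ) (Ms Ms' : List Term), Ms.length ≠ Ms'.length →
    ¬ R (E.enc ((Term.var x).apps Ms)) (E.enc ((Term.var x).apps Ms'))
  head : ∀ (x y : ℕ) (Ms Ms' : List Term), x ≠ y →
    ¬ R (E.enc ((Term.var x).apps Ms)) (E.enc ((Term.var y).apps Ms'))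

/-- The encoding of `λ x. M` is unrelated by `R` to the encoding of `Ω` and to the encoding of
any term `y M₁ ⋯ Mₙ`. -/
def LamUnrelated (R : AgentRel S) (x : ℕ) (M : Term) : Prop :=
  ¬ R (E.enc (Term.lam x M)) (E.enc Term.Omega) ∧
  ∀ (y : ℕ) (Ms : List Term), ¬ R (E.enc (Term.lam x M)) (E.enc ((Term.var y).apps Ms))

/-- Soundness for Lévy-Longo trees. -/
def SoundForLT (R : AgentRel S) : Prop := ∀ M N : Term, R (E.enc M) (E.enc N) → levyLongoTree M = levyLongoTree N

/-- Soundness for Böhm trees. -/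
def SoundForBT (R : AgentRel S) : Prop := ∀ M N : Term, R (E.enc M) (E.enc N) → bohmTree M = bohmTree N

end Encoding

/-! Pull `eqv` back along the encoding: let Q relate M and N when their encodings are related.
Compositionality and rule β make Q a λ-theory (`Encoding.isTheory`). Equality of trees follows by
coinduction (`corec_eq_of_bisim`) once Q is a bisimulation for the map from a term to the root of
its tree and its children.

Two cancellations drive this. Abstractions cancel by β alone: weaken λx.M and apply it to x
(`IsTheory.of_bind`). Arguments of a common head variable cancel because the inverse of a variable
context exposes each argument behind a rendez-vous; cancelling it leaves two instances F⟨z⟩ and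
G⟨z⟩, and plainness recovers F and G (`HasInverse.rel_of_rel_fill`). `SeparatesHeads` collects what
Q then satisfies, and the rest concerns λ-terms only.

For Lévy–Longo trees, a term related to an abstraction must itself reduce to one, so Q preserves the
number of abstractions uncovered, and with it solvability and order. For Böhm trees only
abstractions with solvable bodies are separated. This is enough: an unsolvable is related to Ω or to
λx₁…xₙ.Ω, and no such term is related to a head normal form (`not_binds_omega_hnf`). -/

namespace Term

/-! ### Renaming and substitution -/

theorem liftRen_congr {ρ ρ' : ℕ → ℕ} {M : Term} (h : ∀ k ∈ (bind M).fv, ρ k = ρ' k) :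
    ∀ k ∈ M.fv, liftRen ρ k = liftRen ρ' k
  | 0, _ => rfl
  | k + 1, hk => congrArg Nat.succ (h k hk)

theorem rename_congr {ρ ρ' : ℕ → ℕ} {M : Term} (h : ∀ k ∈ M.fv, ρ k = ρ' k) :
    M.rename ρ = M.rename ρ' := by
  induction M generalizing ρ ρ' with
  | var k => exact congrArg var (h k rfl)
  | bind M ih => exact congrArg bind (ih (liftRen_congr h))
  | app M N ihM ihN =>
    exact congrArg₂ app (ihM fun k hk => h k (Or.inl hk)) (ihN fun k hk => h k (Or.inr hk))

theorem rename_rename (ρ ρ' : ℕ → ℕ) (M : Term) :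
    (M.rename ρ).rename ρ' = M.rename (ρ' ∘ ρ) := by
  induction M generalizing ρ ρ' with
  | var k => rfl
  | bind M ih =>
    refine congrArg bind ((ih _ _).trans (congrArg (M.rename ·) (funext fun k => ?_)))
    cases k <;> rfl
  | app M N ihM ihN => exact congrArg₂ app (ihM _ _) (ihN _ _)

theorem msubst_rename (θ : ℕ → Term) (ρ : ℕ → ℕ) (M : Term) :
    (M.rename ρ).msubst θ = M.msubst (θ ∘ ρ) := by
  induction M generalizing θ ρ with
  | var k => rfl
  | bind M ih =>
    refine congrArg bind ((ih _ _).trans (congrArg (fun θ => M.msubst θ) (funext fun k => ?_)))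
    cases k <;> rfl
  | app M N ihM ihN => exact congrArg₂ app (ihM _ _) (ihN _ _)

theorem msubst_congr {θ θ' : ℕ → Term} {M : Term} (h : ∀ k ∈ M.fv, θ k = θ' k) :
    M.msubst θ = M.msubst θ' := by
  induction M generalizing θ θ' with
  | var k => exact h k rfl
  | bind M ih =>
    refine congrArg bind (ih fun k hk => ?_)
    cases k with
    | zero => rfl
    | succ k => exact congrArg (rename Nat.succ) (h k hk)
  | app M N ihM ihN =>
    exact congrArg₂ app (ihM fun k hk => h k (Or.inl hk)) (ihN fun k hk => h k (Or.inr hk))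

theorem msubst_var (ρ : ℕ → ℕ) (M : Term) : M.msubst (fun k => var (ρ k)) = M.rename ρ := by
  induction M generalizing ρ with
  | var k => rfl
  | bind M ih =>
    refine congrArg bind (Eq.trans ?_ (ih _))
    refine congrArg (fun θ => M.msubst θ) (funext fun k => ?_)
    cases k <;> rfl
  | app M N ihM ihN => exact congrArg₂ app (ihM _) (ihN _)

theorem rename_id (M : Term) : M.rename id = M := by
  induction M with
  | var k => rfl
  | bind M ih =>
    refine congrArg bind (Eq.trans (congrArg (M.rename ·) (funext fun k => ?_)) ih)
    cases k <;> rfl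
  | app M N ihM ihN => exact congrArg₂ app ihM ihN

theorem msubst_eq_self {θ : ℕ → Term} {M : Term} (h : ∀ k ∈ M.fv, θ k = var k) :
    M.msubst θ = M :=
  (msubst_congr h).trans ((msubst_var id M).trans (rename_id M))

theorem exists_fv_lt (M : Term) : ∃ K, ∀ k ∈ M.fv, k < K := by
  induction M with
  | var k => exact ⟨k + 1, by rintro _ rfl; exact Nat.lt_succ_self _⟩
  | bind M ih =>
    obtain ⟨K, hK⟩ := ih
    exact ⟨K, fun k hk => (Nat.lt_succ_self k).trans (hK _ hk)⟩
  | app M N ihM ihN =>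
    obtain ⟨K, hK⟩ := ihM
    obtain ⟨L, hL⟩ := ihN
    refine ⟨max K L, ?_⟩
    rintro k (hk | hk)
    · exact lt_max_of_lt_left (hK k hk)
    · exact lt_max_of_lt_right (hL k hk)

theorem finite_fv (M : Term) : M.fv.Finite :=
  let ⟨K, hK⟩ := M.exists_fv_lt
  (Set.finite_lt_nat K).subset hK

theorem subst_var (M : Term) (x y : ℕ) :
    M.subst x (var y) = M.rename (fun k => if k = x then y else k) := by
  rw [← msubst_var]
  refine congrArg (fun θ => M.msubst θ) (funext fun k => ?_)
  split <;> rfl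

/-- The renaming that turns the index bound by an outermost binder into the variable `x`. -/
def openRen (x : ℕ) : ℕ → ℕ
  | 0 => x
  | k + 1 => k

/-- Bridge between the two notations: encodings are specified on the named `lam`, head reduction on
the de Bruijn `bind`. A fresh x loses nothing. -/
theorem bind_eq_lam {M : Term} {x : ℕ} (hx : x ∉ (bind M).fv) :
    bind M = lam x (M.rename (openRen x)) := by
  refine congrArg bind (Eq.symm ?_)
  rw [rename_rename]
  refine (rename_congr fun k hk => ?_).trans (rename_id M)
  cases k with
  | zero => simp [openRen]
  | succ k =>
    have : k ≠ x := fun h => hx (h ▸ hk)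
    simp [openRen, this]

theorem subst_rename_openRen {M : Term} {x : ℕ} (hx : x ∉ (bind M).fv) (N : Term) :
    (M.rename (openRen x)).subst x N = contract M N := by
  refine (msubst_rename _ _ _).trans (msubst_congr fun k hk => ?_)
  cases k with
  | zero => simp [openRen]
  | succ k =>
    have : k ≠ x := fun h => hx (h ▸ hk)
    simp [openRen, this]

/-- Weakening an abstraction and applying it to the variable 0 gives back the body; this is what
makes abstractions cancellable. -/
theorem contract_shift (M : Term) : contract (M.rename (liftRen Nat.succ)) (var 0) = M := by
  refine (msubst_rename _ _ _).trans (msubst_eq_self fun k _ => ?_)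
  cases k <;> rfl

/-! ### Nested abstractions and applications -/

theorem apps_concat (M : Term) (Ms : List Term) (N : Term) :
    M.apps (Ms ++ [N]) = app (M.apps Ms) N := by
  simp [apps]

theorem binds_add (m n : ℕ) (M : Term) : binds (m + n) M = binds m (binds n M) := by
  induction m with
  | zero => rw [Nat.zero_add]; rfl
  | succ m ih => rw [Nat.succ_add]; exact congrArg bind ih

theorem not_isLam_apps_var (y : ℕ) (Ms : List Term) : ¬ IsLam ((var y).apps Ms) := by
  rintro ⟨M, h⟩
  induction Ms using List.reverseRecOn with
  | nil => cases h
  | append_singleton Ms N _ => rw [apps_concat] at h; cases h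

theorem apps_var_inj {y y' : ℕ} {Ms Ms' : List Term}
    (h : (var y).apps Ms = (var y').apps Ms') : y = y' ∧ Ms = Ms' := by
  induction Ms using List.reverseRecOn generalizing Ms' with
  | nil =>
    cases Ms' using List.reverseRecOn with
    | nil => cases h; exact ⟨rfl, rfl⟩
    | append_singleton Ms' N' => rw [apps_concat] at h; cases h
  | append_singleton Ms N ih =>
    cases Ms' using List.reverseRecOn with
    | nil => rw [apps_concat] at h; cases h
    | append_singleton Ms' N' =>
      rw [apps_concat, apps_concat] at h
      injection h with h₁ h₂
      obtain ⟨rfl, rfl⟩ := ih h₁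
      exact ⟨rfl, by rw [h₂]⟩

theorem binds_apps_var_inj {n n' y y' : ℕ} {Ms Ms' : List Term}
    (h : binds n ((var y).apps Ms) = binds n' ((var y').apps Ms')) :
    n = n' ∧ y = y' ∧ Ms = Ms' := by
  induction n generalizing n' with
  | zero =>
    cases n' with
    | zero =>
      obtain ⟨rfl, rfl⟩ := apps_var_inj h
      exact ⟨rfl, rfl, rfl⟩
    | succ n' => exact absurd ⟨_, h⟩ (not_isLam_apps_var y Ms)
  | succ n ih =>
    cases n' with
    | zero => exact absurd ⟨_, h.symm⟩ (not_isLam_apps_var y' Ms')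
    | succ n' =>
      injection h with h
      obtain ⟨rfl, rfl, rfl⟩ := ih h
      exact ⟨rfl, rfl, rfl⟩

theorem exists_rename_apps_var (ρ : ℕ → ℕ) (y : ℕ) (Ms : List Term) :
    ∃ Ms', ((var y).apps Ms).rename ρ = (var (ρ y)).apps Ms' := by
  induction Ms using List.reverseRecOn with
  | nil => exact ⟨[], rfl⟩
  | append_singleton Ms N ih =>
    obtain ⟨Ms', h⟩ := ih
    refine ⟨Ms' ++ [N.rename ρ], ?_⟩
    rw [apps_concat, apps_concat, ← h]
    rfl

theorem exists_rename_binds_apps_var (ρ : ℕ → ℕ) (n y : ℕ) (Ms : List Term) :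
    ∃ y' Ms', (binds n ((var y).apps Ms)).rename ρ = binds n ((var y').apps Ms') := by
  induction n generalizing ρ with
  | zero => exact ⟨_, exists_rename_apps_var ρ y Ms⟩
  | succ n ih =>
    obtain ⟨y', Ms', h⟩ := ih (liftRen ρ)
    exact ⟨y', Ms', congrArg bind h⟩

theorem fv_binds_Omega (n : ℕ) : (binds n Omega).fv = ∅ := by
  induction n with
  | zero => ext k; simp [binds, Omega, lam, rename, fv]
  | succ n ih => ext k; simp [binds, fv, ih]

/-! ### Head reduction -/

theorem HeadStep.deterministic {M N N' : Term} (h : HeadStep M N) (h' : HeadStep M N') :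
    N = N' := by
  induction h generalizing N' with
  | beta M N =>
    cases h' with
    | beta => rfl
    | appL _ hM _ => exact absurd ⟨_, rfl⟩ hM
  | appL N hM _ ih =>
    cases h' with
    | beta => exact absurd ⟨_, rfl⟩ hM
    | appL _ _ h => rw [ih h]
  | under _ ih =>
    cases h' with
    | under h => rw [ih h]

theorem not_headStep_apps_var (y : ℕ) (Ms : List Term) (N : Term) :
    ¬ HeadStep ((var y).apps Ms) N := by
  induction Ms using List.reverseRecOn generalizing N with
  | nil => intro h; cases h
  | append_singleton Ms L ih =>
    rw [apps_concat]
    intro h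
    generalize hM : (var y).apps Ms = M at h
    cases h with
    | beta M => exact not_isLam_apps_var y Ms ⟨_, hM⟩
    | appL _ _ h => exact ih _ (hM ▸ h)

theorem not_headStep_hnf (n y : ℕ) (Ms : List Term) (N : Term) :
    ¬ HeadStep (binds n ((var y).apps Ms)) N := by
  induction n generalizing N with
  | zero => exact not_headStep_apps_var y Ms N
  | succ n ih =>
    intro h
    cases h with
    | under h => exact ih _ h

/-- Head reduction is deterministic and head normal forms do not step, so the choices in `ltStep`
and `btStep` are harmless. -/
theorem HasHnf.unique {M : Term} {n n' y y' : ℕ} {Ms Ms' : List Term} (h : M.HasHnf n y Ms)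
    (h' : M.HasHnf n' y' Ms') : n = n' ∧ y = y' ∧ Ms = Ms' := by
  obtain h | h := Relation.ReflTransGen.total_of_right_unique
    (fun _ _ _ h h' => h.deterministic h') h h'
  · obtain h | ⟨_, h, _⟩ := h.cases_head
    · exact binds_apps_var_inj h
    · exact absurd h (not_headStep_hnf _ _ _ _)
  · obtain h | ⟨_, h, _⟩ := h.cases_head
    · exact binds_apps_var_inj h.symm
    · exact absurd h (not_headStep_hnf _ _ _ _)

theorem HeadRed.binds {M N : Term} (h : HeadRed M N) (n : ℕ) :
    HeadRed (binds n M) (binds n N) := by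
  induction n with
  | zero => exact h
  | succ n ih => exact ih.lift bind fun _ _ h => HeadStep.under h

theorem solvable_of_headRed_binds {M N : Term} {n : ℕ} (h : HeadRed M (binds n N))
    (hN : N.Solvable) : M.Solvable := by
  obtain ⟨m, y, Ms, hm⟩ := hN
  refine ⟨n + m, y, Ms, h.trans ?_⟩
  rw [binds_add]
  exact HeadRed.binds hm n

/-- If neither an abstraction nor a variable-headed term is reached, there is no head normal form
and no abstraction is ever uncovered. -/
theorem headRed_cases (M : Term) :
    (∃ M', HeadRed M (bind M')) ∨ (∃ y Ms, HeadRed M ((var y).apps Ms)) ∨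
      M.UnsolvableOfOrder 0 := by
  by_contra! h
  obtain ⟨hl, hv, h⟩ := h
  refine h ⟨?_, ⟨M, .refl⟩, ?_⟩
  · rintro ⟨n, y, Ms, hM⟩
    cases n with
    | zero => exact hv y Ms hM
    | succ n => exact hl _ hM
  · rintro n ⟨M', hM⟩
    cases n with
    | zero => exact le_rfl
    | succ n => exact absurd hM (hl _)

theorem UnsolvableOfOrder.exists_headRed {M : Term} {n : ℕ} (h : M.UnsolvableOfOrder n) :
    ∃ N, HeadRed M (binds n N) ∧ N.UnsolvableOfOrder 0 := by
  obtain ⟨hs, ⟨N, hN⟩, hmax⟩ := h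
  refine ⟨N, hN, fun h => hs (solvable_of_headRed_binds hN h), ⟨N, .refl⟩, ?_⟩
  rintro m ⟨N', hN'⟩
  -- Abstractions uncovered by the core N add to the n already found, so maximality of n forces m =
  -- 0.
  have := hmax (show Uncovers M (n + m) from ⟨N', by
    rw [binds_add]; exact hN.trans (hN'.binds n)⟩)
  omega

theorem Uncovers.of_le {M : Term} {m n : ℕ} (h : M.Uncovers n) (hmn : m ≤ n) : M.Uncovers m := by
  obtain ⟨N, h⟩ := h
  obtain ⟨k, rfl⟩ := Nat.exists_eq_add_of_le hmn
  exact ⟨_, by rwa [binds_add] at h⟩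

/-- The numbers of abstractions that can be uncovered form a nonempty initial segment of ℕ, which
has a maximum unless it is everything. -/
theorem unsolvable_order_cases {M : Term} (h : ¬ M.Solvable) :
    (∃ n, M.UnsolvableOfOrder n) ∨ M.UnsolvableOfInfiniteOrder := by
  by_cases hM : ∀ n, M.Uncovers n
  · exact Or.inr ⟨h, hM⟩
  · push Not at hM
    obtain ⟨b, hb⟩ := hM
    have hbd : BddAbove {m | M.Uncovers m} :=
      ⟨b, fun m hm => not_lt.1 fun hlt => hb (hm.of_le hlt.le)⟩
    exact Or.inl ⟨_, h, Nat.sSup_mem ⟨0, M, .refl⟩ hbd, fun m hm => le_csSup hbd hm⟩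

/-! ### Lambda-theories -/

/-- A congruence on lambda-terms that contains rule `β`. -/
structure IsTheory (Q : Term → Term → Prop) : Prop where
  refl : ∀ M, Q M M
  symm : ∀ {M N}, Q M N → Q N M
  trans : ∀ {M N L}, Q M N → Q N L → Q M L
  lam : ∀ x {M N}, Q M N → Q (lam x M) (lam x N)
  app : ∀ {M M' N N'}, Q M M' → Q N N' → Q (app M N) (app M' N')
  beta : ∀ x M N, Q (Term.app (Term.lam x M) N) (M.subst x N)

namespace IsTheory

variable {Q : Term → Term → Prop}

/-- Expand both sides to β-redexes with argument L, and use congruence. -/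
theorem subst (hQ : IsTheory Q) {M N : Term} (h : Q M N) (x : ℕ) (L : Term) :
    Q (M.subst x L) (N.subst x L) :=
  hQ.trans (hQ.symm (hQ.beta x M L)) (hQ.trans (hQ.app (hQ.lam x h) (hQ.refl L)) (hQ.beta x N L))

/-- A theory is closed under substitution for one variable at a time, so the shift is done index by
index from the top: when m moves to m + 1, that slot is already vacant. -/
theorem rename_succ (hQ : IsTheory Q) {M N : Term} (h : Q M N) :
    Q (M.rename Nat.succ) (N.rename Nat.succ) := by
  obtain ⟨K, hK⟩ := (Term.app M N).exists_fv_lt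
  have key : ∀ m ≤ K, Q (M.rename fun k => if k < m then k else k + 1)
      (N.rename fun k => if k < m then k else k + 1) := by
    intro m hm
    induction hm using Nat.decreasingInduction with
    | self =>
      have hid : ∀ L : Term, (∀ k ∈ L.fv, k < K) →
          L.rename (fun k => if k < K then k else k + 1) = L := fun L hL =>
        (rename_congr fun k hk => if_pos (hL k hk)).trans (rename_id L)
      rwa [hid M fun k hk => hK k (Or.inl hk), hid N fun k hk => hK k (Or.inr hk)]
    | of_succ m hm ih =>
      have hs := hQ.subst ih m (var (m + 1))
      have hc : (fun k => if k = m then m + 1 else k) ∘ (fun k => if k < m + 1 then k else k + 1) =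
          fun k => if k < m then k else k + 1 := by
        funext k
        dsimp only [Function.comp_apply]
        split_ifs <;> omega
      rwa [subst_var, subst_var, rename_rename, rename_rename, hc] at hs
  simpa using key 0 (Nat.zero_le _)

/-- A simultaneous renaming is made sequential by first shifting all variables beyond every target,
then sending them to their targets one at a time. -/
theorem rename (hQ : IsTheory Q) {M N : Term} (h : Q M N) (ρ : ℕ → ℕ) :
    Q (M.rename ρ) (N.rename ρ) := by
  obtain ⟨K₀, hK₀⟩ := (Term.app M N).exists_fv_lt
  obtain ⟨K, hle, hρ⟩ : ∃ K, K₀ ≤ K ∧ ∀ k < K₀, ρ k < K := by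
    -- The sum dominates every target ρ k with k < K₀, so no variable already placed is hit by a
    -- later substitution.
    refine ⟨K₀ + ∑ k ∈ Finset.range K₀, (ρ k + 1), Nat.le_add_right _ _, fun k hk => ?_⟩
    have := Finset.single_le_sum (f := fun k => ρ k + 1) (fun _ _ => Nat.zero_le _)
      (Finset.mem_range.2 hk)
    omega
  have shift : ∀ m, Q (M.rename (· + m)) (N.rename (· + m)) := by
    intro m
    induction m with
    | zero => exact (rename_id M).symm ▸ (rename_id N).symm ▸ h
    | succ m ih =>
      have hs := hQ.rename_succ ih
      rwa [rename_rename, rename_rename] at hs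
  have key : ∀ m ≤ K₀, Q (M.rename fun k => if k < m then ρ k else k + K)
      (N.rename fun k => if k < m then ρ k else k + K) := by
    intro m
    induction m with
    | zero => simpa using shift K
    | succ m ih =>
      intro hm
      have hs := hQ.subst (ih (by omega)) (m + K) (var (ρ m))
      have hc : (fun k => if k = m + K then ρ m else k) ∘ (fun k => if k < m then ρ k else k + K) =
          fun k => if k < m + 1 then ρ k else k + K := by
        funext k
        dsimp only [Function.comp_apply]
        rcases lt_trichotomy k m with hk | rfl | hk
        · have := hρ k (by omega)
          rw [if_pos hk, if_neg (by omega), if_pos (by omega)]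
        · simp
        · rw [if_neg (show ¬ k < m by omega), if_neg (show ¬ k + K = m + K by omega),
            if_neg (by omega)]
      rwa [subst_var, subst_var, rename_rename, rename_rename, hc] at hs
  have hM : ∀ L : Term, (∀ k ∈ L.fv, k < K₀) →
      L.rename (fun k => if k < K₀ then ρ k else k + K) = L.rename ρ := fun L hL =>
    rename_congr fun k hk => if_pos (hL k hk)
  have := key K₀ le_rfl
  rwa [hM M fun k hk => hK₀ k (Or.inl hk), hM N fun k hk => hK₀ k (Or.inr hk)] at this

theorem bind (hQ : IsTheory Q) {M N : Term} (h : Q M N) : Q (bind M) (bind N) := by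
  obtain ⟨K, hK⟩ := (Term.app (Term.bind M) (Term.bind N)).exists_fv_lt
  rw [bind_eq_lam (x := K) fun hk => lt_irrefl _ (hK _ (Or.inl hk)),
    bind_eq_lam (x := K) fun hk => lt_irrefl _ (hK _ (Or.inr hk))]
  exact hQ.lam K (hQ.rename h _)

theorem binds (hQ : IsTheory Q) {M N : Term} (h : Q M N) (n : ℕ) : Q (binds n M) (binds n N) := by
  induction n with
  | zero => exact h
  | succ n ih => exact hQ.bind ih

theorem contract (hQ : IsTheory Q) (M N : Term) : Q (Term.app (Term.bind M) N) (contract M N) := by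
  obtain ⟨K, hK⟩ := (Term.bind M).exists_fv_lt
  have hx : K ∉ (Term.bind M).fv := fun hk => lt_irrefl _ (hK _ hk)
  rw [bind_eq_lam hx, ← subst_rename_openRen hx]
  exact hQ.beta _ _ _

theorem headStep (hQ : IsTheory Q) {M N : Term} (h : HeadStep M N) : Q M N := by
  induction h with
  | beta M N => exact hQ.contract M N
  | appL N _ _ ih => exact hQ.app ih (hQ.refl N)
  | under _ ih => exact hQ.bind ih

theorem headRed (hQ : IsTheory Q) {M N : Term} (h : HeadRed M N) : Q M N := by
  induction h with
  | refl => exact hQ.refl M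
  | tail _ h ih => exact hQ.trans ih (hQ.headStep h)

/-- Both abstractions are weakened and applied to the same variable; β then returns their bodies. -/
theorem of_bind (hQ : IsTheory Q) {M N : Term} (h : Q (Term.bind M) (Term.bind N)) : Q M N := by
  have key : ∀ L, Q (Term.app ((Term.bind L).rename Nat.succ) (var 0)) L := fun L => by
    have := hQ.contract (L.rename (liftRen Nat.succ)) (var 0)
    rwa [contract_shift] at this
  exact hQ.trans (hQ.symm (key M))
    (hQ.trans (hQ.app (hQ.rename h Nat.succ) (hQ.refl (var 0))) (key N))

theorem of_binds (hQ : IsTheory Q) {M N : Term} {n : ℕ} (h : Q (Term.binds n M) (Term.binds n N)) :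
    Q M N := by
  induction n with
  | zero => exact h
  | succ n ih => exact ih (hQ.of_bind h)

end IsTheory

end Term

namespace Term

/-! ### Trees and theories that separate head normal forms -/

/-- The arity k is kept apart from `Ms.length` so that two related terms can be given literally the
same label, as the bisimulation requires. -/
theorem HasHnf.ltStep_eq {M : Term} {n y k : ℕ} {Ms : List Term} (h : M.HasHnf n y Ms)
    (hk : k = Ms.length) :
    ltStep M = ⟨LTLabel.node n y k, fun i => Ms.get (Fin.cast hk i)⟩ := by
  subst hk
  have hex : ∃ p : ℕ × ℕ × List Term, M.HasHnf p.1 p.2.1 p.2.2 := ⟨(n, y, Ms), h⟩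
  have hc : hex.choose = (n, y, Ms) := by
    obtain ⟨h₁, h₂, h₃⟩ := hex.choose_spec.unique h
    exact Prod.ext h₁ (Prod.ext h₂ h₃)
  exact (dif_pos hex).trans (congrArg (fun p : ℕ × ℕ × List Term =>
    (⟨LTLabel.node p.1 p.2.1 p.2.2.length, fun i => p.2.2.get i⟩ : LTShape Term)) hc)

theorem HasHnf.btStep_eq {M : Term} {n y k : ℕ} {Ms : List Term} (h : M.HasHnf n y Ms)
    (hk : k = Ms.length) :
    btStep M = ⟨BTLabel.node n y k, fun i => Ms.get (Fin.cast hk i)⟩ := by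
  subst hk
  have hex : ∃ p : ℕ × ℕ × List Term, M.HasHnf p.1 p.2.1 p.2.2 := ⟨(n, y, Ms), h⟩
  have hc : hex.choose = (n, y, Ms) := by
    obtain ⟨h₁, h₂, h₃⟩ := hex.choose_spec.unique h
    exact Prod.ext h₁ (Prod.ext h₂ h₃)
  exact (dif_pos hex).trans (congrArg (fun p : ℕ × ℕ × List Term =>
    (⟨BTLabel.node p.1 p.2.1 p.2.2.length, fun i => p.2.2.get i⟩ : BTShape Term)) hc)

theorem UnsolvableOfOrder.ltStep_eq {M : Term} {n : ℕ} (h : M.UnsolvableOfOrder n) :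
    ltStep M = ⟨LTLabel.bot n, Fin.elim0⟩ := by
  have hex : ∃ n, M.UnsolvableOfOrder n := ⟨n, h⟩
  have hc : hex.choose = n := hex.choose_spec.2.unique h.2
  exact (dif_neg fun ⟨_, hp⟩ => h.1 ⟨_, _, _, hp⟩).trans ((dif_pos hex).trans
    (congrArg (fun n => (⟨LTLabel.bot n, Fin.elim0⟩ : LTShape Term)) hc))

theorem UnsolvableOfInfiniteOrder.ltStep_eq {M : Term} (h : M.UnsolvableOfInfiniteOrder) :
    ltStep M = ⟨LTLabel.top, Fin.elim0⟩ :=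
  (dif_neg fun ⟨_, hp⟩ => h.1 ⟨_, _, _, hp⟩).trans
    (dif_neg fun ⟨n, hn⟩ => absurd (hn.2.2 (h.2 (n + 1))) (Nat.not_succ_le_self n))

theorem btStep_eq_of_not_solvable {M : Term} (h : ¬ M.Solvable) :
    btStep M = ⟨BTLabel.bot, Fin.elim0⟩ :=
  dif_neg fun ⟨_, hp⟩ => h ⟨_, _, _, hp⟩

/-- Coinduction stated on the seeds: it suffices that related terms have the same label and related
children. -/
theorem corec_eq_of_bisim {P : PFunctor} {α : Type*} (g : α → P α) (R : α → α → Prop)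
    (h : ∀ a b, R a b → ∃ l f f', g a = ⟨l, f⟩ ∧ g b = ⟨l, f'⟩ ∧ ∀ i, R (f i) (f' i))
    {a b : α} (hab : R a b) : PFunctor.M.corec g a = PFunctor.M.corec g b := by
  refine PFunctor.M.bisim
    (fun s t => ∃ a b, R a b ∧ s = PFunctor.M.corec g a ∧ t = PFunctor.M.corec g b)
    ?_ _ _ ⟨a, b, hab, rfl, rfl⟩
  rintro _ _ ⟨a, b, hab, rfl, rfl⟩
  obtain ⟨l, f, f', ha, hb, hf⟩ := h a b hab
  refine ⟨l, PFunctor.M.corec g ∘ f, PFunctor.M.corec g ∘ f', ?_, ?_,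
    fun i => ⟨f i, f' i, hf i, rfl, rfl⟩⟩
  · rw [PFunctor.M.dest_corec, ha]; rfl
  · rw [PFunctor.M.dest_corec, hb]; rfl

/-- A lambda-theory that equates the unsolvable terms of order `0`, separates them from the terms
`x M₁ ⋯ Mₙ`, and for the latter determines the head, the number of arguments, and the arguments. -/
structure SeparatesHeads (Q : Term → Term → Prop) : Prop extends IsTheory Q where
  order_zero : ∀ M, M.UnsolvableOfOrder 0 → Q M Omega
  omega : ∀ x Ms, ¬ Q Omega ((var x).apps Ms)
  length : ∀ x Ms Ms', Ms.length ≠ Ms'.length → ¬ Q ((var x).apps Ms) ((var x).apps Ms')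
  head : ∀ x y Ms Ms', x ≠ y → ¬ Q ((var x).apps Ms) ((var y).apps Ms')
  args : ∀ x n (Ms Ns : Fin n → Term),
    Q ((var x).apps (List.ofFn Ms)) ((var x).apps (List.ofFn Ns)) → ∀ i, Q (Ms i) (Ns i)

/-- The theory does not relate the abstraction `λ x. M` to `Ω` or to a term `y M₁ ⋯ Mₙ`. -/
def LamSeparated (Q : Term → Term → Prop) (x : ℕ) (M : Term) : Prop :=
  ¬ Q (lam x M) Omega ∧ ∀ y Ms, ¬ Q (lam x M) ((var y).apps Ms)

/-! ### Related head normal forms have the same root and related children -/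

namespace SeparatesHeads

variable {Q : Term → Term → Prop}

theorem args_of_apps (hQ : SeparatesHeads Q) {y y' : ℕ} {Ms Ns : List Term}
    (h : Q ((var y).apps Ms) ((var y').apps Ns)) :
    y = y' ∧ ∃ hl : Ms.length = Ns.length, ∀ i : Fin Ms.length,
      Q (Ms.get i) (Ns.get (Fin.cast hl i)) := by
  obtain rfl : y = y' := by_contra fun hy => hQ.head _ _ _ _ hy h
  have hl : Ms.length = Ns.length := by_contra fun hl => hQ.length _ _ _ hl h
  refine ⟨rfl, hl, hQ.args y _ _ _ ?_⟩
  have hN : List.ofFn (fun i => Ns.get (Fin.cast hl i)) = Ns :=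
    List.ext_get (by simp [hl]) fun i _ _ => by simp
  rwa [List.ofFn_get, hN]

/-- After cancelling n abstractions, a variable-headed term faces an abstraction whose body is still
a head normal form, hence solvable; separation for solvable bodies excludes this. -/
theorem not_lam_hnf (hQ : SeparatesHeads Q)
    (hlam : ∀ x M, M.Solvable → LamSeparated Q x M) {n n' y y' : ℕ} {Ms Ns : List Term}
    (h : Q (binds n ((var y).apps Ms)) (binds n' ((var y').apps Ns))) : ¬ n < n' := by
  intro hlt
  obtain ⟨k, rfl⟩ := Nat.exists_eq_add_of_lt hlt
  rw [Nat.add_assoc, binds_add] at h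
  have h := hQ.symm (hQ.of_binds h)
  obtain ⟨K, hK⟩ := (binds (k + 1) ((var y').apps Ns)).exists_fv_lt
  have hx : K ∉ (bind (binds k ((var y').apps Ns))).fv := fun hk => lt_irrefl _ (hK _ hk)
  obtain ⟨y'', Ns', hr⟩ := exists_rename_binds_apps_var (openRen K) k y' Ns
  change Q (bind _) _ at h
  rw [bind_eq_lam hx, hr] at h
  exact (hlam _ _ ⟨k, y'', Ns', .refl⟩).2 _ _ h

theorem hnf_eq (hQ : SeparatesHeads Q)
    (hlam : ∀ x M, M.Solvable → LamSeparated Q x M) {M N : Term} {n n' y y' : ℕ}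
    {Ms Ns : List Term} (hM : M.HasHnf n y Ms) (hN : N.HasHnf n' y' Ns) (h : Q M N) :
    n = n' ∧ y = y' ∧ ∃ hl : Ms.length = Ns.length, ∀ i : Fin Ms.length,
      Q (Ms.get i) (Ns.get (Fin.cast hl i)) := by
  have h := hQ.trans (hQ.symm (hQ.headRed hM)) (hQ.trans h (hQ.headRed hN))
  obtain rfl : n = n' := le_antisymm
    (not_lt.1 (hQ.not_lam_hnf hlam (hQ.symm h))) (not_lt.1 (hQ.not_lam_hnf hlam h))
  exact ⟨rfl, hQ.args_of_apps (hQ.of_binds h)⟩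

/-! ### Böhm trees -/

/-- Here the abstractions have unsolvable bodies, so `LamSeparated` is not available. Instead both
sides are applied to a variable: the left loses an abstraction, the right gains an argument, and
induction ends at Ω itself. -/
theorem not_binds_omega_apps (hQ : SeparatesHeads Q) (n y : ℕ) (Ms : List Term) :
    ¬ Q (binds n Omega) ((var y).apps Ms) := by
  induction n generalizing Ms with
  | zero => exact hQ.omega y Ms
  | succ n ih =>
    intro h
    refine ih (Ms ++ [var 0]) ?_
    rw [apps_concat]
    -- The body is closed, so the argument disappears.
    have hc : contract (binds n Omega) (var 0) = binds n Omega :=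
      msubst_eq_self fun k hk => by rw [fv_binds_Omega] at hk; exact absurd hk (Set.notMem_empty k)
    have hb := hQ.contract (binds n Omega) (var 0)
    rw [hc] at hb
    exact hQ.trans (hQ.symm hb) (hQ.app h (hQ.refl (var 0)))

theorem not_omega_hnf (hQ : SeparatesHeads Q)
    (hlam : ∀ x M, M.Solvable → LamSeparated Q x M) (n y : ℕ) (Ms : List Term) :
    ¬ Q Omega (binds n ((var y).apps Ms)) := by
  intro h
  cases n with
  | zero => exact hQ.omega _ _ h
  | succ n =>
    obtain ⟨K, hK⟩ := (binds (n + 1) ((var y).apps Ms)).exists_fv_lt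
    have hx : K ∉ (bind (binds n ((var y).apps Ms))).fv := fun hk => lt_irrefl _ (hK _ hk)
    obtain ⟨y', Ms', hr⟩ := exists_rename_binds_apps_var (openRen K) n y Ms
    change Q _ (bind _) at h
    rw [bind_eq_lam hx, hr] at h
    exact (hlam _ _ ⟨n, y', Ms', .refl⟩).1 (hQ.symm h)

/-- Cancelling the common abstractions leaves Ω against a head normal form, or λx₁…xₖ.Ω against a
variable-headed term. -/
theorem not_binds_omega_hnf (hQ : SeparatesHeads Q)
    (hlam : ∀ x M, M.Solvable → LamSeparated Q x M) (m n y : ℕ) (Ms : List Term) :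
    ¬ Q (binds m Omega) (binds n ((var y).apps Ms)) := by
  intro h
  rcases Nat.le_total m n with hmn | hmn
  · obtain ⟨k, rfl⟩ := Nat.exists_eq_add_of_le hmn
    rw [binds_add] at h
    exact hQ.not_omega_hnf hlam _ _ _ (hQ.of_binds h)
  · obtain ⟨k, rfl⟩ := Nat.exists_eq_add_of_le hmn
    rw [binds_add] at h
    exact hQ.not_binds_omega_apps _ _ _ (hQ.of_binds h)

/-- Were N unsolvable, it would be related to λx₁…xₘ.Ω or to Ω, and so would the head normal form of
M. -/
theorem solvable_of_rel (hQ : SeparatesHeads Q)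
    (hinf : ∀ M, M.UnsolvableOfInfiniteOrder → Q M Omega)
    (hlam : ∀ x M, M.Solvable → LamSeparated Q x M) {M N : Term} (h : Q M N)
    (hM : M.Solvable) : N.Solvable := by
  by_contra hN
  obtain ⟨n, y, Ms, hM⟩ := hM
  have h := hQ.trans (hQ.symm h) (hQ.headRed hM)
  obtain ⟨m, hm⟩ | hi := unsolvable_order_cases hN
  · obtain ⟨N', hN', h0⟩ := hm.exists_headRed
    have hNO := hQ.trans (hQ.headRed hN') (hQ.binds (hQ.order_zero _ h0) m)
    exact hQ.not_binds_omega_hnf hlam _ _ _ _ (hQ.trans (hQ.symm hNO) h)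
  · exact hQ.not_omega_hnf hlam _ _ _ (hQ.trans (hQ.symm (hinf _ hi)) h)

theorem bohmTree_eq (hQ : SeparatesHeads Q)
    (hinf : ∀ M, M.UnsolvableOfInfiniteOrder → Q M Omega)
    (hlam : ∀ x M, M.Solvable → LamSeparated Q x M) {M N : Term} (h : Q M N) :
    bohmTree M = bohmTree N := by
  refine corec_eq_of_bisim btStep Q (fun M N h => ?_) h
  by_cases hM : M.Solvable
  · have hN := hQ.solvable_of_rel hinf hlam h hM
    obtain ⟨n, y, Ms, hM⟩ := hM
    obtain ⟨n', y', Ns, hN⟩ := hN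
    obtain ⟨rfl, rfl, hl, hc⟩ := hQ.hnf_eq hlam hM hN h
    exact ⟨_, _, _, hM.btStep_eq rfl, hN.btStep_eq hl, hc⟩
  · have hN := fun hN => hM (hQ.solvable_of_rel hinf hlam (hQ.symm h) hN)
    exact ⟨_, _, _, btStep_eq_of_not_solvable hM, btStep_eq_of_not_solvable hN, fun i => i.elim0⟩

/-! ### Lévy–Longo trees -/

/-- Of the three outcomes of head reduction, separation of all abstractions excludes the other two.
-/
theorem exists_bind_of_rel (hQ : SeparatesHeads Q) (hlam : ∀ x M, LamSeparated Q x M)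
    {M N : Term} (h : Q (bind M) N) : ∃ N', HeadRed N (bind N') := by
  obtain ⟨K, hK⟩ := (bind M).exists_fv_lt
  rw [bind_eq_lam fun hk => lt_irrefl K (hK _ hk)] at h
  obtain hN | ⟨y, Ms, hN⟩ | hN := headRed_cases N
  · exact hN
  · exact absurd (hQ.trans h (hQ.headRed hN)) ((hlam _ _).2 y Ms)
  · exact absurd (hQ.trans h (hQ.order_zero _ hN)) (hlam _ _).1

theorem exists_binds_of_rel (hQ : SeparatesHeads Q) (hlam : ∀ x M, LamSeparated Q x M)
    {M N : Term} {n : ℕ} (h : Q (binds n M) N) : ∃ N', HeadRed N (binds n N') ∧ Q M N' := by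
  induction n generalizing N with
  | zero => exact ⟨N, .refl, h⟩
  | succ n ih =>
    obtain ⟨N₁, hN₁⟩ := hQ.exists_bind_of_rel hlam h
    obtain ⟨N', hN', h'⟩ := ih (hQ.of_bind (hQ.trans h (hQ.headRed hN₁)))
    exact ⟨N', hN₁.trans (hN'.binds 1), h'⟩

theorem uncovers_of_rel (hQ : SeparatesHeads Q) (hlam : ∀ x M, LamSeparated Q x M)
    {M N : Term} (h : Q M N) {n : ℕ} (hM : M.Uncovers n) : N.Uncovers n := by
  obtain ⟨M', hM⟩ := hM
  obtain ⟨N', hN, _⟩ := hQ.exists_binds_of_rel hlam (hQ.trans (hQ.symm (hQ.headRed hM)) h)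
  exact ⟨N', hN⟩

theorem solvable_of_rel_of_lamSeparated (hQ : SeparatesHeads Q)
    (hlam : ∀ x M, LamSeparated Q x M) {M N : Term} (h : Q M N) (hM : M.Solvable) :
    N.Solvable := by
  obtain ⟨n, y, Ms, hM⟩ := hM
  obtain ⟨N', hN, h'⟩ := hQ.exists_binds_of_rel hlam (hQ.trans (hQ.symm (hQ.headRed hM)) h)
  refine solvable_of_headRed_binds hN ?_
  obtain ⟨L, hL⟩ | ⟨y', Ns, hN⟩ | hN := headRed_cases N'
  · obtain ⟨L', hL'⟩ := hQ.exists_bind_of_rel hlam (hQ.symm (hQ.trans h' (hQ.headRed hL)))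
    obtain hL' | ⟨_, hL', _⟩ := hL'.cases_head
    · exact absurd ⟨_, hL'⟩ (not_isLam_apps_var y Ms)
    · exact absurd hL' (not_headStep_apps_var _ _ _)
  · exact ⟨0, y', Ns, hN⟩
  · exact absurd (hQ.symm (hQ.trans h' (hQ.order_zero _ hN))) (hQ.omega y Ms)

theorem levyLongoTree_eq (hQ : SeparatesHeads Q) (hlam : ∀ x M, LamSeparated Q x M)
    {M N : Term} (h : Q M N) : levyLongoTree M = levyLongoTree N := by
  refine corec_eq_of_bisim ltStep Q (fun M N h => ?_) h
  by_cases hM : M.Solvable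
  · have hN := hQ.solvable_of_rel_of_lamSeparated hlam h hM
    obtain ⟨n, y, Ms, hM⟩ := hM
    obtain ⟨n', y', Ns, hN⟩ := hN
    obtain ⟨rfl, rfl, hl, hc⟩ := hQ.hnf_eq (fun x M _ => hlam x M) hM hN h
    exact ⟨_, _, _, hM.ltStep_eq rfl, hN.ltStep_eq hl, hc⟩
  · have hN := fun hN => hM (hQ.solvable_of_rel_of_lamSeparated hlam (hQ.symm h) hN)
    have hu : ∀ n, M.Uncovers n ↔ N.Uncovers n := fun n =>
      ⟨hQ.uncovers_of_rel hlam h, hQ.uncovers_of_rel hlam (hQ.symm h)⟩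
    obtain ⟨n, hn⟩ | hi := unsolvable_order_cases hM
    · have hn' : N.UnsolvableOfOrder n := ⟨hN, by
        have := hn.2
        simpa only [hu] using this⟩
      exact ⟨_, _, _, hn.ltStep_eq, hn'.ltStep_eq, fun i => i.elim0⟩
    · have hi' : N.UnsolvableOfInfiniteOrder := ⟨hN, fun n => (hu n).1 (hi.2 n)⟩
      exact ⟨_, _, _, hi.ltStep_eq, hi'.ltStep_eq, fun i => i.elim0⟩

end SeparatesHeads

end Term

/-! ### Renaming of agents -/

namespace PreAgent

variable {S : Sorting}

theorem rename_congr {N : Type} {σ : N → S.Srt} {κ : Kind S} (P : PreAgent S N σ κ)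
    {N' : Type} {σ' : N' → S.Srt} {ρ ρ' : N → N'} (hρ : ∀ n, σ' (ρ n) = σ n)
    (hρ' : ∀ n, σ' (ρ' n) = σ n) (h : ∀ n ∈ P.fn, ρ n = ρ' n) :
    P.rename ρ hρ = P.rename ρ' hρ' := by
  have lift : ∀ {N N' : Type} {ss : List S.Srt} {ρ ρ' : N → N'} {s : Set (WithBound ss N)},
      (∀ n, Sum.inr n ∈ s → ρ n = ρ' n) → ∀ n ∈ s, Sum.map id ρ n = Sum.map id ρ' n := by
    rintro N N' ss ρ ρ' s h (i | n) hn
    · rfl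
    · exact congrArg Sum.inr (h n hn)
  induction P generalizing N' with
  | nil => rfl
  | inp a ss hc P ih =>
    have ha : ρ a = ρ' a := h a (Or.inl rfl)
    simp only [rename, ha]
    exact congrArg (inp (ρ' a) ss _) (ih _ _ (lift fun n hn => h n (Or.inr hn)))
  | out a bs hc =>
    have ha : ρ a = ρ' a := h a (Or.inl rfl)
    have hb : bs.map ρ = bs.map ρ' := List.map_congr_left fun n hn => h n (Or.inr hn)
    simp only [rename, ha, hb]
  | par P Q ihP ihQ =>
    simp only [rename, ihP hρ hρ' fun n hn => h n (Or.inl hn),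
      ihQ hρ hρ' fun n hn => h n (Or.inr hn)]
  | res s P ih => exact congrArg (res s) (ih _ _ (lift h))
  | bang a ss hc P ih =>
    have ha : ρ a = ρ' a := h a (Or.inl rfl)
    simp only [rename, ha]
    exact congrArg (bang (ρ' a) ss _) (ih _ _ (lift fun n hn => h n (Or.inr hn)))
  | app F b hb ih =>
    have ha : ρ b = ρ' b := h b (Or.inr rfl)
    simp only [rename, ha, ih hρ hρ' fun n hn => h n (Or.inl hn)]
  | abs s P ih => exact congrArg (abs s) (ih _ _ (lift h))

theorem rename_rename {N : Type} {σ : N → S.Srt} {κ : Kind S} (P : PreAgent S N σ κ)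
    {N' N'' : Type} {σ' : N' → S.Srt} {σ'' : N'' → S.Srt} {ρ : N → N'} {ρ' : N' → N''}
    (hρ : ∀ n, σ' (ρ n) = σ n) (hρ' : ∀ n, σ'' (ρ' n) = σ' n) :
    (P.rename ρ hρ).rename ρ' hρ' =
      P.rename (ρ' ∘ ρ) (fun n => (hρ' (ρ n)).trans (hρ n)) := by
  induction P generalizing N' N'' with
  | nil => rfl
  | inp a ss hc P ih => simp only [rename, ih, Sum.map_comp_map, Function.comp_id]; rfl
  | out a bs hc => simp only [rename, List.map_map]; rfl
  | par P Q ihP ihQ => simp only [rename, ihP, ihQ]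
  | res s P ih => simp only [rename, ih, Sum.map_comp_map, Function.comp_id]
  | bang a ss hc P ih => simp only [rename, ih, Sum.map_comp_map, Function.comp_id]; rfl
  | app F b hb ih => simp only [rename, ih]; rfl
  | abs s P ih => simp only [rename, ih, Sum.map_comp_map, Function.comp_id]

theorem rename_id {N : Type} {σ : N → S.Srt} {κ : Kind S} (P : PreAgent S N σ κ) :
    P.rename id (fun _ => rfl) = P := by
  induction P with
  | nil => rfl
  | inp a ss hc P ih => simp only [rename, Sum.map_id_id, ih]; rfl
  | out a bs hc => simp only [rename, List.map_id]; rfl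
  | par P Q ihP ihQ => simp only [rename, ihP, ihQ]
  | res s P ih => simp only [rename, Sum.map_id_id, ih]
  | bang a ss hc P ih => simp only [rename, Sum.map_id_id, ih]; rfl
  | app F b hb ih => simp only [rename, ih]; rfl
  | abs s P ih => simp only [rename, Sum.map_id_id, ih]

theorem rename_eq_self {N : Type} {σ : N → S.Srt} {κ : Kind S} (P : PreAgent S N σ κ)
    {ρ : N → N} (hρ : ∀ n, σ (ρ n) = σ n) (h : ∀ n ∈ P.fn, ρ n = n) : P.rename ρ hρ = P :=
  (P.rename_congr hρ (fun _ => rfl) h).trans P.rename_id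

end PreAgent

/-! ### Cancelling parameters and invertible contexts -/

section Abstractions

variable {S : Sorting}

theorem Proc.subst_self (P : Proc S) (a : Name S) : P.subst a a rfl = P :=
  PreAgent.rename_eq_self _ _ fun n _ => by
    unfold substName
    split
    · next h => exact h.symm
    · rfl

/-- Every abstraction has the form `(z) P`, for any name `z` that is not free in it. -/
theorem Abst.exists_eq_mk {z : Name S} (A : Abst S z.sort) (hz : z ∉ A.fn) :
    ∃ P, A = Abst.mk z P := by
  cases A with
  | abs s P =>
    have hs : ∀ n, Name.sort ((Sum.elim (fun _ => z) id : WithBound [z.sort] (Name S) → Name S) n) =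
        boundSort [z.sort] Name.sort n := by
      rintro (i | n)
      · simp [boundSort]
      · rfl
    -- Name the bound slot z; as z is not free in the abstraction, binding it again captures exactly
    -- that slot.
    refine ⟨P.rename (Sum.elim (fun _ => z) id) hs, congrArg (PreAgent.abs z.sort) ?_⟩
    rw [PreAgent.rename_rename]
    refine (PreAgent.rename_eq_self P _ ?_).symm
    rintro (i | n) hn
    · have : i = ⟨0, Nat.zero_lt_one⟩ := Fin.ext (Nat.lt_one_iff.1 i.isLt)
      subst this
      simp [bindNames]
    · have hnz : n ≠ z := fun h => hz (h ▸ hn)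
      simp [bindNames, hnz]

/-- With A = (z)P, plainness at the trivial substitution {z/z} relates A⟨z⟩ to P; the same holds for
B, and the context (z)[·] closes the bodies again. -/
theorem rel_of_rel_app {eqv le : AgentRel S} (h_eqv : IsCongruence eqv) (h_plain : IsPlain le)
    (h_incl : ∀ (κ : Kind S) (A B : Agent S κ), le.converse A B → eqv A B) {s : S.Srt}
    {A B : Abst S s} {z : Name S} (hz : z.sort = s) (hA : z ∉ A.fn) (hB : z ∉ B.fn)
    (h : eqv (A.app z hz) (B.app z hz)) : eqv A B := by
  subst hz
  obtain ⟨P, rfl⟩ := A.exists_eq_mk hA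
  obtain ⟨Q, rfl⟩ := B.exists_eq_mk hB
  have key : ∀ P : Proc S, eqv ((Abst.mk z P).app z rfl) P := fun P => by
    have := h_plain P z z rfl
    rw [P.subst_self] at this
    exact h_incl _ _ _ this
  exact h_eqv.ctx 1 (fun _ => Kind.proc) _ (Ctx.abs z (Ctx.hole 0)) (fun _ => P) (fun _ => Q)
    fun _ => h_eqv.trans (h_eqv.symm (key P)) (h_eqv.trans h (key Q))

/-- The extracting context D does not depend on the fillers, so congruence applies to it. It yields
two rendez-vous with equal prefixes, which cancel down to the instances of A i and B i at the fresh
name z. -/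
theorem HasInverse.rel_of_rel_fill {eqv le : AgentRel S} (h_eqv : IsCongruence eqv)
    (h_plain : IsPlain le)
    (h_incl : ∀ (κ : Kind S) (A B : Agent S κ), le.converse A B → eqv A B)
    (h_cancel : RendezvousCancellation eqv) {n : ℕ} {ss : Fin n → S.Srt} {s : S.Srt}
    {C : Ctx S (fun i => Kind.abs (ss i)) (Kind.abs s)} (hC : HasInverse le.converse C)
    {X : Finset (Name S)} {A B : (j : Fin n) → Abst S (ss j)}
    (hA : ∀ j, ∀ m ∈ (A j).fn, m.IsVar ∧ m ∈ X) (hB : ∀ j, ∀ m ∈ (B j).fn, m.IsVar ∧ m ∈ X)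
    (h : eqv (C.fill A) (C.fill B)) (i : Fin n) : eqv (A i) (B i) := by
  obtain ⟨D, bs, cs, a, b, z, hac, hbz, hz, hb, hbc, hacs, hzcs, haz, haX, hbX, hzX, hD⟩ := hC i X
  have fresh : ∀ {x : Name S} {F : Abst S (ss i)}, x ∉ X → x ≠ z →
      (∀ m ∈ F.fn, m.IsVar ∧ m ∈ X) → x ∉ (F.app z hz).fn := by
    rintro x F hx hxz hF (h | h)
    · exact hx (hF x h).2
    · exact hxz h
  have hbz' : b ≠ z := fun h => hzcs (h ▸ hbc hb)
  have hDAB : eqv (D.fill fun _ => C.fill A) (D.fill fun _ => C.fill B) :=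
    h_eqv.ctx 1 (fun _ => Kind.abs s) _ D (fun _ => C.fill A) (fun _ => C.fill B) fun _ => h
  refine rel_of_rel_app h_eqv h_plain h_incl hz (fun h => hzX (hA i z h).2)
    (fun h => hzX (hB i z h).2) ?_
  exact h_cancel bs a cs hac b z hbz _ _ hb hbc hacs haz hbz'
    (fresh haX haz (hA i)) (fresh haX haz (hB i)) (fresh hbX hbz' (hA i)) (fresh hbX hbz' (hB i))
    (h_eqv.trans (h_eqv.symm (h_incl _ _ _ (hD A hA)))
      (h_eqv.trans hDAB (h_incl _ _ _ (hD B hB))))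

theorem Ctx.fill_comp {m n : ℕ} {κs : Fin n → Kind S} {κs' : Fin m → Kind S}
    (D : (i : Fin n) → Ctx S κs' (κs i)) (A : (i : Fin m) → Agent S (κs' i)) {κ : Kind S}
    (C : Ctx S κs κ) : (C.comp D).fill A = C.fill fun i => (D i).fill A := by
  induction C with
  | hole i => rfl
  | const B => rfl
  | inp a bs hb h C ih => simp only [comp, fill, ih]
  | par C C' ih ih' => simp only [comp, fill, ih, ih']
  | res a C ih => simp only [comp, fill, ih]
  | bang a bs hb h C ih => simp only [comp, fill, ih]
  | app C b h ih => simp only [comp, fill, ih]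
  | abs a C ih => simp only [comp, fill, ih]

end Abstractions

/-! ### The λ-theory induced by an encoding -/

namespace Encoding

variable {S : Sorting} (E : Encoding S)

theorem enc_apps_var (x n : ℕ) (Ms : Fin n → Term) :
    E.enc ((Term.var x).apps (List.ofFn Ms)) = (E.varCtx x n).fill fun i => E.enc (Ms i) := by
  induction n with
  | zero => exact E.enc_var x
  | succ n ih =>
    rw [List.ofFn_succ', List.concat_eq_append, Term.apps_concat, E.enc_app, ih, varCtx,
      Ctx.fill_comp]
    congr 1
    funext i
    fin_cases i
    · exact (Ctx.fill_comp (κs' := fun _ : Fin (n + 1) => Kind.abs E.loc)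
        (fun j => Ctx.hole j.castSucc) (fun j => E.enc (Ms j)) (E.varCtx x n)).symm
    · rfl

theorem isTheory {eqv le : AgentRel S} (h_eqv : IsCongruence eqv)
    (h_incl : ∀ (κ : Kind S) (A B : Agent S κ), le.converse A B → eqv A B)
    (h_beta : E.ValidatesBeta le.converse) : Term.IsTheory fun M N => eqv (E.enc M) (E.enc N) where
  refl M := h_eqv.refl _
  symm h := h_eqv.symm h
  trans h h' := h_eqv.trans h h'
  lam x {M N} h := by
    rw [E.enc_lam, E.enc_lam]
    exact h_eqv.ctx 1 (fun _ => Kind.abs E.loc) _ (E.absCtx x) (fun _ => E.enc M)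
      (fun _ => E.enc N) fun _ => h
  app {M M' N N'} h h' := by
    rw [E.enc_app, E.enc_app]
    refine h_eqv.ctx 2 (fun _ => Kind.abs E.loc) _ E.appCtx ![E.enc M, E.enc N]
      ![E.enc M', E.enc N'] fun i => ?_
    fin_cases i
    · exact h
    · exact h'
  beta x M N := h_incl _ _ _ (h_beta x M N)

theorem separatesHeads {eqv le : AgentRel S} (h_eqv : IsCongruence eqv) (h_plain : IsPlain le)
    (h_incl : ∀ (κ : Kind S) (A B : Agent S κ), le.converse A B → eqv A B)
    (h_cancel : RendezvousCancellation eqv) (h_beta : E.ValidatesBeta le.converse)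
    (h_order_zero : ∀ M : Term, M.UnsolvableOfOrder 0 → eqv (E.enc M) (E.enc Term.Omega))
    (h_heads : E.HeadsUnrelated eqv)
    (h_inv_var : ∀ x n : ℕ, HasInverse le.converse (E.varCtx x n)) :
    Term.SeparatesHeads fun M N => eqv (E.enc M) (E.enc N) where
  toIsTheory := E.isTheory h_eqv h_incl h_beta
  order_zero := h_order_zero
  omega := h_heads.omega
  length := h_heads.length
  head := h_heads.head
  args x n Ms Ns h i := by
    -- The finite set X must be fixed before the inverse is taken, so it collects the free variables
    -- of both tuples.
    have hX : (⋃ j, Name.var '' (Ms j).fv ∪ Name.var '' (Ns j).fv : Set (Name S)).Finite :=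
      Set.finite_iUnion fun j => ((Ms j).finite_fv.image _).union ((Ns j).finite_fv.image _)
    rw [E.enc_apps_var, E.enc_apps_var] at h
    refine (h_inv_var x n).rel_of_rel_fill h_eqv h_plain h_incl h_cancel (X := hX.toFinset)
      (fun j m hm => ?_) (fun j m hm => ?_) h i
    · obtain ⟨k, hk, rfl⟩ := E.fn_enc _ m hm
      exact ⟨⟨k, rfl⟩, hX.mem_toFinset.2 (Set.mem_iUnion.2 ⟨j, Or.inl ⟨k, hk, rfl⟩⟩)⟩
    · obtain ⟨k, hk, rfl⟩ := E.fn_enc _ m hm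
      exact ⟨⟨k, rfl⟩, hX.mem_toFinset.2 (Set.mem_iUnion.2 ⟨j, Or.inr ⟨k, hk, rfl⟩⟩)⟩

end Encoding
/-- Soundness conditions, for Lévy-Longo trees and for Böhm trees.  `eqv` is the congruence, `le`
the auxiliary precongruence. -/
theorem theoremt (S : Sorting) (E : Encoding S) (eqv le : AgentRel S)
    (h_eqv : IsCongruence eqv) (h_le : IsPrecongruence le) (h_plain : IsPlain le)
    (h_incl : ∀ (κ : Kind S) (A B : Agent S κ), le.converse A B → eqv A B)
    (h_cancel : RendezvousCancellation eqv)
    (h_beta : E.ValidatesBeta le.converse)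
    (h_order_zero : ∀ M : Term, M.UnsolvableOfOrder 0 → eqv (E.enc M) (E.enc Term.Omega))
    (h_heads : E.HeadsUnrelated eqv)
    (h_inv_abs : ∀ x : ℕ, HasInverse le.converse (E.absCtx x))
    (h_inv_var : ∀ x n : ℕ, HasInverse le.converse (E.varCtx x n)) :
    ((∀ (x : ℕ) (M : Term), E.LamUnrelated eqv x M) → E.SoundForLT eqv) ∧
    ((∀ M : Term, M.UnsolvableOfInfiniteOrder → eqv (E.enc M) (E.enc Term.Omega)) →
      (∀ (x : ℕ) (M : Term), M.Solvable → E.LamUnrelated eqv x M) → E.SoundForBT eqv) := by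

  have hQ := E.separatesHeads h_eqv h_plain h_incl h_cancel h_beta h_order_zero h_heads h_inv_var
  exact ⟨fun hlam _ _ h => hQ.levyLongoTree_eq hlam h,
    fun hinf hlam _ _ h => hQ.bohmTree_eq hinf hlam h⟩
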